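/- Let $\theta>0$ and let $X_1,X_2,\dots$ be i.i.d. exponential with mean $\theta$; write $F(x\mid\theta)=1-e^{-x/\theta}$ for $x\ge 0$. Let $0=c_0<c_1<\dots<c_m<\infty$ be group boundaries and let $t<T$ be truncation points with $c_{l-1}\le t\le c_l\le c_r<T\le c_{r+1}\le c_m$, where $1\le l\le r$. At the boundaries let $F_n(c_j)=\frac1n\#\{i\le n: X_i\le c_j\}$; between them $F_n$ is the linear interpolation (ogive), and $f_n=\frac{F_n(c_j)-F_n(c_{j-1})}{c_j-c_{j-1}}$ on $(c_{j-1},c_j]$ is the histogram. The grouped sample truncated mean is $$\widehat\mu=\frac{\int_t^T x f_n(x)\,dx}{F_n(T)-F_n(t)},$$ and $\mu=g_{tT}(\theta)$ is the same expression with $F_n(c_j)$ replaced by $F(c_j\mid\theta)$ for all $j$. Put $$A_1=\tfrac{c_l-t}{c_l-c_{l-1}},\quad B_1=\tfrac{t-c_{l-1}}{c_l-c_{l-1}},\quad A_2=\tfrac{c_{r+1}-T}{c_{r+1}-c_r},\quad B_2=\tfrac{T-c_r}{c_{r+1}-c_r},$$ $$u_l=\tfrac{c_l^2-t^2}{2(c_l-c_{l-1})},\quad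 v_i=\tfrac{c_i+c_{i-1}}2,\quad z_r=\tfrac{T^2-c_r^2}{2(c_{r+1}-c_r)},$$ and, for $p=(p_1,\dots,p_m)$ and $p_0=0$, $g_\mu(p)=N/H$ with $$N=u_l(p_l-p_{l-1})+\sum_{i=l+1}^r v_i(p_i-p_{i-1})+z_r(p_{r+1}-p_r),\qquad H=A_2p_r+B_2p_{r+1}-A_1p_{l-1}-B_1p_l .$$ Let $\mathbf F=(F(c_1\mid\theta),\dots,F(c_m\mid\theta))$, let $\Sigma$ be the symmetric $m\times m$ matrix with entries $F(c_j\mid\theta)(1-F(c_{j'}\mid\theta))$ for $j\le j'$, let $D_\mu$ be the (row) gradient of $g_\mu$ at $\mathbf F$, and $\Sigma_\mu=D_\mu\Sigma D_\mu'$. We write that $Y_n$ is $\mathcal{AN}(a,n^{-1}\sigma^2)$ if $\sigma^2\ge0$ and $\sqrt n\,(Y_n-a)\to N(0,\sigma^2)$ in distribution, where $N(0,0)$ is the point mass at $0$. 1. For every $n$, almost surely $\widehat\mu=g_\mu(F_n(c_1),\dots,F_n(c_m))$. For every $\theta'>0$, with $\mathbf F'=(F(c_1\mid\theta'),\dots,F(c_m\mid\theta'))$,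 we have $H(\mathbf F')>0$ and $g_{tT}(\theta')=g_\mu(\mathbf F')$. 2. $\widehat\mu$ is $\mathcal{AN}(g_\mu(\mathbf F),\,n^{-1}\Sigma_\mu)$. 3. At every $p$ with $H(p)\neq0$ the partial derivatives $\partial g_\mu/\partial p_j$, $1\le j\le m$, exist and are as follows. If $l<r$: $$\frac{\partial g_\mu}{\partial p_j}=\begin{cases}\frac{-u_lH+A_1N}{H^2},&j=l-1,\\ \frac{(u_l-v_{l+1})H+B_1N}{H^2},&j=l,\\ \frac{c_{j-1}-c_{j+1}}{2H},&l+1\le j\le r-1,\\ \frac{(v_r-z_r)H-A_2N}{H^2},&j=r,\\ \frac{z_rH-B_2N}{H^2},&j=r+1,\\ 0,&\text{otherwise.}\end{cases}$$ If $l=r$: $$\frac{\partial g_\mu}{\partial p_j}=\begin{cases}\frac{-u_lH+A_1N}{H^2},&j=l-1,\\ \frac{(u_l-z_r)H-(A_2-B_1)N}{H^2},&j=l,\\ \frac{z_rH-B_2N}{H^2},&j=l+1,\\ 0,&\text{otherwise.}\end{cases}$$ 4. Suppose in addition that $t<c_r$, i.e. that $t$ and $T$ do not lie in one closed interval $[c_r,c_{r+1}]$.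 Then: (a) $\Sigma_\mu>0$, and $g_{tT}$ is injective on $(0,\infty)$. Let $g_\theta$ be its inverse function on its range, extended by a constant outside the range, and let $\widehat\theta_{\rm MTuM}=g_\theta(\widehat\mu)$. With probability tending to $1$, $\widehat\theta_{\rm MTuM}>0$ and $g_{tT}(\widehat\theta_{\rm MTuM})=\widehat\mu$. (b) For every $\theta>0$, with $\mu=g_{tT}(\theta)$, $g_\theta$ is differentiable at $\mu$ with $$g_\theta'(\mu)=\frac{A-B}{\Lambda+\Delta}\ \text{ if } l=r,\qquad g_\theta'(\mu)=\frac{A-B}{\Gamma+\Delta}\ \text{ if } l<r,$$ the denominators being nonzero, where $e_j=e^{-c_j/\theta}$, $A=A_2+B_2-A_1-B_1$, $B=A_2e_r+B_2e_{r+1}-A_1e_{l-1}-B_1e_l$, $$\Lambda=\tfrac{u_l}{\theta^2}(c_{l-1}e_{l-1}-c_le_l)+\tfrac{z_r}{\theta^2}(c_re_r-c_{r+1}e_{r+1}),\qquad \Gamma=\Lambda+\sum_{i=l+1}^r\tfrac{v_i}{\theta^2}(c_{i-1}e_{i-1}-c_ie_i),$$ $$\Delta=\tfrac{\mu}{\theta^2}(A_2c_re_r+B_2c_{r+1}e_{r+1}-A_1c_{l-1}e_{l-1}-B_1c_le_l).$$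 (c) $(g_\theta'(\mu))^2\Sigma_\mu>0$, and $\widehat\theta_{\rm MTuM}$ is $\mathcal{AN}(\theta,\,n^{-1}(g_\theta'(\mu))^2\Sigma_\mu)$. -/

import Mathlib

open MeasureTheory ProbabilityTheory Filter Topology

noncomputable section

/-- Group boundaries `0 = c 0 < c 1 < ⋯ < c m < ∞` and truncation points `t`, `T` with
`c (l-1) ≤ t ≤ c l ≤ c r < T ≤ c (r+1) ≤ c m`. The case `t = 0` is covered (with `l = 1`).
The values `c j` for `j > m` play no role. -/
structure GroupedTrunc where
  m : ℕ
  c : ℕ → ℝ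
  t : ℝ
  T : ℝ
  l : ℕ
  r : ℕ
  c_zero : c 0 = 0
  c_lt : ∀ j < m, c j < c (j + 1)
  one_le_l : 1 ≤ l
  l_le_r : l ≤ r
  r_lt_m : r + 1 ≤ m
  le_t : c (l - 1) ≤ t
  t_le : t ≤ c l
  lt_T : c r < T
  T_le : T ≤ c (r + 1)

/-- The empirical distribution function `n⁻¹ #{i < n : x i ≤ y}` of the sample
`x 0, …, x (n-1)`. -/
def empCdf (x : ℕ → ℝ) (n : ℕ) (y : ℝ) : ℝ :=
  (∑ i ∈ Finset.range n, if x i ≤ y then (1 : ℝ) else 0) / n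

/-- The distribution function `F(· | θ)` of the exponential distribution with mean `θ`. -/
def expCdf (θ : ℝ) (x : ℝ) : ℝ := cdf (expMeasure θ⁻¹) x

/-- `Y n` is asymptotically normal `AN(a, v / n)`: `√n (Y n - a)` converges in distribution to the
centred normal law with variance `v` (the point mass at `0` when `v = 0`). -/
def IsAN {Ω : Type*} [MeasurableSpace Ω] (P : Measure Ω) [IsProbabilityMeasure P]
    (Y : ℕ → Ω → ℝ) (a v : ℝ) : Prop :=
  0 ≤ v ∧ TendstoInDistribution (fun (n : ℕ) ω => √(n : ℝ) * (Y n ω - a)) atTop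
    (id : ℝ → ℝ) (fun _ => P) (gaussianReal 0 v.toNNReal)

namespace GroupedTrunc

variable (D : GroupedTrunc)

/-- The linear interpolation on `(0, c m]` of a distribution function `G` known at the group
boundaries. For the empirical distribution function this is the ogive. -/
def ogive (G : ℝ → ℝ) (x : ℝ) : ℝ :=
  ∑ j ∈ Finset.range D.m, if D.c j < x ∧ x ≤ D.c (j + 1) then
    (D.c (j + 1) - x) / (D.c (j + 1) - D.c j) * G (D.c j)
      + (x - D.c j) / (D.c (j + 1) - D.c j) * G (D.c (j + 1))
  else 0

/-- The density of the linearized distribution function on `(0, c m]`. For the empirical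
distribution function this is the histogram. -/
def histogram (G : ℝ → ℝ) (x : ℝ) : ℝ :=
  ∑ j ∈ Finset.range D.m, if D.c j < x ∧ x ≤ D.c (j + 1) then
    (G (D.c (j + 1)) - G (D.c j)) / (D.c (j + 1) - D.c j)
  else 0

/-- The mean, truncated to `(t, T]`, of the linearization of `G`. -/
def truncMean (G : ℝ → ℝ) : ℝ :=
  (∫ x in D.t..D.T, x * D.histogram G x) / (D.ogive G D.T - D.ogive G D.t)

/-- The grouped sample truncated mean `μ̂` of the sample `x 0, …, x (n-1)`. -/
def muHat (x : ℕ → ℝ) (n : ℕ) : ℝ := D.truncMean (empCdf x n)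

/-- The linearized population truncated mean `g_{tT}(θ)`. -/
def gtT (θ : ℝ) : ℝ := D.truncMean (expCdf θ)

/-- The inverse function `g_θ` of `g_{tT} : (0, ∞) → ℝ`; the value outside the range of `g_{tT}` is
an arbitrary constant. -/
def gTheta (μ : ℝ) : ℝ := Function.invFunOn D.gtT (Set.Ioi 0) μ

/-- The estimator `θ̂_MTuM`, the solution of `g_{tT}(θ) = μ̂`. -/
def thetaHat (x : ℕ → ℝ) (n : ℕ) : ℝ := D.gTheta (D.muHat x n)

def A₁ : ℝ := (D.c D.l - D.t) / (D.c D.l - D.c (D.l - 1))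
def B₁ : ℝ := (D.t - D.c (D.l - 1)) / (D.c D.l - D.c (D.l - 1))
def A₂ : ℝ := (D.c (D.r + 1) - D.T) / (D.c (D.r + 1) - D.c D.r)
def B₂ : ℝ := (D.T - D.c D.r) / (D.c (D.r + 1) - D.c D.r)
def u : ℝ := (D.c D.l ^ 2 - D.t ^ 2) / (2 * (D.c D.l - D.c (D.l - 1)))
def v (i : ℕ) : ℝ := (D.c i + D.c (i - 1)) / 2
def z : ℝ := (D.T ^ 2 - D.c D.r ^ 2) / (2 * (D.c (D.r + 1) - D.c D.r))

/-- Extends `p = (p_1, …, p_m)` by `p_0 = 0`; the coordinate `j : Fin m` of `p` is `p_{j+1}`. -/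
def ext (p : Fin D.m → ℝ) : ℕ → ℝ
  | 0 => 0
  | j + 1 => if h : j < D.m then p ⟨j, h⟩ else 0

/-- The numerator `N` of `g_μ`. -/
def N (p : Fin D.m → ℝ) : ℝ :=
  D.u * (D.ext p D.l - D.ext p (D.l - 1))
    + ∑ i ∈ Finset.Icc (D.l + 1) D.r, D.v i * (D.ext p i - D.ext p (i - 1))
    + D.z * (D.ext p (D.r + 1) - D.ext p D.r)

/-- The denominator `H` of `g_μ`. -/
def H (p : Fin D.m → ℝ) : ℝ :=
  D.A₂ * D.ext p D.r + D.B₂ * D.ext p (D.r + 1) - D.A₁ * D.ext p (D.l - 1) - D.B₁ * D.ext p D.l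

def gMu (p : Fin D.m → ℝ) : ℝ := D.N p / D.H p

/-- The vector `(G(c 1), …, G(c m))`. -/
def atBoundaries (G : ℝ → ℝ) : Fin D.m → ℝ := fun j => G (D.c (j + 1))

/-- The vector `𝐅 = (F(c 1 | θ), …, F(c m | θ))`. -/
def Fvec (θ : ℝ) : Fin D.m → ℝ := D.atBoundaries (expCdf θ)

/-- The matrix `Σ`, with entries `F(c j | θ) (1 - F(c j' | θ))` for `j ≤ j'`, symmetric. -/
def Sig (θ : ℝ) : Matrix (Fin D.m) (Fin D.m) ℝ :=
  Matrix.of fun j k => D.Fvec θ (min j k) * (1 - D.Fvec θ (max j k))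

/-- The gradient `D_μ`, the vector of partial derivatives of `g_μ` at `𝐅`. -/
def Dmu (θ : ℝ) : Fin D.m → ℝ :=
  fun j => deriv (fun s => D.gMu (Function.update (D.Fvec θ) j s)) (D.Fvec θ j)

/-- `Σ_μ = D_μ Σ D_μ'`. -/
def SigMu (θ : ℝ) : ℝ := dotProduct (D.Dmu θ) ((D.Sig θ).mulVec (D.Dmu θ))

/-- The explicit partial derivative `∂g_μ/∂p_j` at `p` when `l < r`. -/
def partialLt (p : Fin D.m → ℝ) (j : ℕ) : ℝ :=
  if j + 1 = D.l then (-D.u * D.H p + D.A₁ * D.N p) / D.H p ^ 2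
  else if j = D.l then ((D.u - D.v (D.l + 1)) * D.H p + D.B₁ * D.N p) / D.H p ^ 2
  else if D.l + 1 ≤ j ∧ j + 1 ≤ D.r then (D.c (j - 1) - D.c (j + 1)) / (2 * D.H p)
  else if j = D.r then ((D.v D.r - D.z) * D.H p - D.A₂ * D.N p) / D.H p ^ 2
  else if j = D.r + 1 then (D.z * D.H p - D.B₂ * D.N p) / D.H p ^ 2
  else 0

/-- The explicit partial derivative `∂g_μ/∂p_j` at `p` when `l = r`. -/
def partialEq (p : Fin D.m → ℝ) (j : ℕ) : ℝ :=
  if j + 1 = D.l then (-D.u * D.H p + D.A₁ * D.N p) / D.H p ^ 2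
  else if j = D.l then ((D.u - D.z) * D.H p - (D.A₂ - D.B₁) * D.N p) / D.H p ^ 2
  else if j = D.l + 1 then (D.z * D.H p - D.B₂ * D.N p) / D.H p ^ 2
  else 0

/-- `e j θ = exp (-c_j / θ)`. -/
def e (j : ℕ) (θ : ℝ) : ℝ := Real.exp (-D.c j / θ)

def cA : ℝ := D.A₂ + D.B₂ - D.A₁ - D.B₁

def cB (θ : ℝ) : ℝ :=
  D.A₂ * D.e D.r θ + D.B₂ * D.e (D.r + 1) θ - D.A₁ * D.e (D.l - 1) θ - D.B₁ * D.e D.l θ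

def cLambda (θ : ℝ) : ℝ :=
  D.u / θ ^ 2 * (D.c (D.l - 1) * D.e (D.l - 1) θ - D.c D.l * D.e D.l θ)
    + D.z / θ ^ 2 * (D.c D.r * D.e D.r θ - D.c (D.r + 1) * D.e (D.r + 1) θ)

def cDelta (θ μ : ℝ) : ℝ :=
  μ / θ ^ 2 * (D.A₂ * D.c D.r * D.e D.r θ + D.B₂ * D.c (D.r + 1) * D.e (D.r + 1) θ
    - D.A₁ * D.c (D.l - 1) * D.e (D.l - 1) θ - D.B₁ * D.c D.l * D.e D.l θ)

def cGamma (θ : ℝ) : ℝ :=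
  D.cLambda θ + ∑ i ∈ Finset.Icc (D.l + 1) D.r,
    D.v i / θ ^ 2 * (D.c (i - 1) * D.e (i - 1) θ - D.c i * D.e i θ)

end GroupedTrunc

end

/-! ### Scalar limit theorems and measurability -/

section Asymptotics

variable {Ω : Type*} [MeasurableSpace Ω] {P : Measure Ω} [IsProbabilityMeasure P]

/-! Both `N` and `H` are weighted sums (`wsum`) of the increments `p i - p (i - 1)` over the groups
`l ≤ i ≤ r + 1`, with weights `share i * mid i` and `share i`. Everything reduces to such linear
functionals of the boundary values.

Asymptotic normality of `μ̂` needs no multivariate limit theorem. With `μ = g_μ(𝐅)`, the identity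
`μ̂ - μ = (N - μ H)(F_n) / H(F_n)` is exact once `H(F_n) ≠ 0`. The numerator is a mean of i.i.d.
bounded terms (`contrib`), centred because `N - μ H` vanishes at `𝐅`; the denominator converges
almost surely to `H(𝐅) > 0`. The scalar central limit theorem and Slutsky's theorem conclude
(`isAN_mean`, `IsAN.of_eventually_eq_mul`), and `SigMu_eq` identifies the variance with `D_μ Σ
D_μ'`.

For `θ̂`, the derivative of `g_{tT}` has the sign of `N' H - N H'`, which is positive by a strict
Chebyshev inequality: midpoints increase from group to group, and so does `q_i' / q_i` for the group
probabilities `q_i`, since `θ + θ² q_i' / q_i` is the conditional mean of an observation given group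
`i` and lies inside that group (`score_bounds`). Hence `g_{tT}` is strictly increasing with nonzero
strict derivative, its inverse is differentiable, and the difference quotient of the inverse carries
the normal limit from `μ̂` to `θ̂`. -/

lemma tendstoInDistribution_gaussianReal_of_hasLaw {Ω' : Type*} [MeasurableSpace Ω']
    {Q : Measure Ω'} [IsProbabilityMeasure Q] {X : ℕ → Ω → ℝ} {Z : Ω' → ℝ} {v : NNReal}
    (h : TendstoInDistribution X atTop Z (fun _ => P) Q) (hZ : HasLaw Z (gaussianReal 0 v) Q) :
    TendstoInDistribution X atTop (id : ℝ → ℝ) (fun _ => P) (gaussianReal 0 v) where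
  forall_aemeasurable := h.forall_aemeasurable
  aemeasurable_limit := aemeasurable_id
  tendsto := by
    convert! h.tendsto using 2
    rw! [hZ.map_eq]
    simp

/-- A form of Slutsky's theorem which covers the delta method: if `Y` is `AN(a, v / n)` and
`Z - b` is eventually `Y - a` times a factor that converges to `ρ`, then `Z` is
`AN(b, ρ² v / n)`. -/
lemma IsAN.of_eventually_eq_mul {Y Z R : ℕ → Ω → ℝ} {a b v ρ : ℝ} (hY : IsAN P Y a v)
    (hR : ∀ n, AEMeasurable (R n) P) (hZ : ∀ n, AEMeasurable (Z n) P)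
    (hRρ : ∀ᵐ ω ∂P, Tendsto (fun n => R n ω) atTop (𝓝 ρ))
    (hZY : ∀ᵐ ω ∂P, ∀ᶠ n in atTop, Z n ω - b = R n ω * (Y n ω - a)) :
    IsAN P Z b (ρ ^ 2 * v) := by
  refine ⟨mul_nonneg (sq_nonneg _) hY.1, ?_⟩
  have hR' : TendstoInMeasure P R atTop (fun _ => ρ) :=
    tendstoInMeasure_of_tendsto_ae (fun n => (hR n).aestronglyMeasurable) hRρ
  have h1 := hY.2.continuous_comp_prodMk_of_tendstoInMeasure_const
    (g := fun x : ℝ × ℝ => x.2 * x.1) (by fun_prop) hR' hR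
  have hlaw : HasLaw (fun ω : ℝ => ρ * id ω) (gaussianReal 0 (ρ ^ 2 * v).toNNReal)
      (gaussianReal 0 v.toNNReal) := by
    have := gaussianReal_const_mul (HasLaw.id (μ := gaussianReal 0 v.toNNReal)) ρ
    convert this using 2
    · simp
    · ext
      rw [Real.coe_toNNReal _ (mul_nonneg (sq_nonneg _) hY.1)]
      simp [Real.coe_toNNReal _ hY.1]
  have h2 := tendstoInDistribution_gaussianReal_of_hasLaw h1 hlaw
  have hZm : ∀ n : ℕ, AEMeasurable (fun ω => √(n : ℝ) * (Z n ω - b)) P :=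
    fun n => ((hZ n).sub_const b).const_mul _
  -- Almost surely the two sequences agree from some index on, so their difference tends to `0` in
  -- probability.
  refine tendstoInDistribution_of_tendstoInMeasure_sub
    (fun (n : ℕ) ω => √(n : ℝ) * (Z n ω - b)) id h2 ?_ hZm
  refine tendstoInMeasure_of_tendsto_ae
    (fun n => ((hZm n).sub (h2.forall_aemeasurable n)).aestronglyMeasurable) ?_
  filter_upwards [hZY] with ω hω
  refine tendsto_const_nhds.congr' ?_
  filter_upwards [hω] with n hn
  simp only [Pi.sub_apply, Pi.zero_apply, hn]
  ring

/-- The central limit theorem for the means of a square integrable function of an i.i.d.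
sequence. -/
lemma isAN_mean {ν : Measure ℝ} {X : ℕ → Ω → ℝ}
    (hlaw : ∀ i, HasLaw (X i) ν P) (hindep : iIndepFun X P) {f : ℝ → ℝ} (hf : Measurable f)
    (hf2 : MemLp f 2 ν) (h0 : ∫ x, f x ∂ν = 0) :
    IsAN P (fun n ω => (∑ i ∈ Finset.range n, f (X i ω)) / n) 0 (∫ x, f x ^ 2 ∂ν) := by
  have hident : ∀ i, IdentDistrib (fun ω => f (X i ω)) (fun ω => f (X 0 ω)) P P := fun i =>
    ((hlaw i).identDistrib (hlaw 0)).comp hf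
  have hind : iIndepFun (fun i ω => f (X i ω)) P := hindep.comp (fun _ => f) (fun _ => hf)
  have hL : MemLp (fun ω => f (X 0 ω)) 2 P := by
    have := hf2
    rw [← (hlaw 0).map_eq] at this
    exact (memLp_map_measure_iff hf.aestronglyMeasurable (hlaw 0).aemeasurable).1 this
  have hmean : P[fun ω => f (X 0 ω)] = 0 := by
    rw [← h0]
    exact (hlaw 0).integral_comp hf.aestronglyMeasurable
  have hvar : Var[fun ω => f (X 0 ω); P] = ∫ x, f x ^ 2 ∂ν := by
    rw [variance_of_integral_eq_zero hL.aemeasurable hmean]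
    exact (hlaw 0).integral_comp (f := fun x => f x ^ 2) (hf.pow_const 2).aestronglyMeasurable
  have key := tendstoInDistribution_inv_sqrt_mul_sum_sub (P := P)
    (X := fun i ω => f (X i ω)) (Y := (id : ℝ → ℝ))
    (HasLaw.id (μ := gaussianReal 0 Var[fun ω => f (X 0 ω); P].toNNReal)) hL hind hident
  rw [hmean] at key
  refine ⟨hvar ▸ variance_nonneg _ _, ?_⟩
  rw [← hvar]
  convert key using 3 with n ω
  rcases Nat.eq_zero_or_pos n with rfl | hn
  · simp
  have : (0 : ℝ) < n := by exact_mod_cast hn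
  have h3 : √(n : ℝ) * √(n : ℝ) = n := Real.mul_self_sqrt this.le
  have h4 : √(n : ℝ) ≠ 0 := (Real.sqrt_pos.2 this).ne'
  rw [mul_zero, sub_zero, sub_zero]
  field_simp
  rw [sq, h3]
  ring

omit [IsProbabilityMeasure P] in
lemma ae_tendsto_mean {ν : Measure ℝ} {X : ℕ → Ω → ℝ}
    (hlaw : ∀ i, HasLaw (X i) ν P) (hindep : iIndepFun X P) {f : ℝ → ℝ} (hf : Measurable f)
    (hint : Integrable f ν) :
    ∀ᵐ ω ∂P, Tendsto (fun n : ℕ => (∑ i ∈ Finset.range n, f (X i ω)) / n) atTop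
      (𝓝 (∫ x, f x ∂ν)) := by
  have hident : ∀ i, IdentDistrib (fun ω => f (X i ω)) (fun ω => f (X 0 ω)) P P := fun i =>
    ((hlaw i).identDistrib (hlaw 0)).comp hf
  have hind : iIndepFun (fun i ω => f (X i ω)) P := hindep.comp (fun _ => f) (fun _ => hf)
  have hL : Integrable (fun ω => f (X 0 ω)) P := by
    have := hint
    rw [← (hlaw 0).map_eq] at this
    exact (integrable_map_measure hf.aestronglyMeasurable (hlaw 0).aemeasurable).1 this
  have key := strong_law_ae_real (fun i ω => f (X i ω)) hL
    (fun i j hij => hind.indepFun hij) hident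
  rwa [show P[fun ω => f (X 0 ω)] = ∫ x, f x ∂ν from
    (hlaw 0).integral_comp hf.aestronglyMeasurable] at key

lemma tendsto_measure_of_ae_tendsto {E : Type*} [PseudoMetricSpace E] {Y : ℕ → Ω → E} {a : E}
    (hY : ∀ n, AEStronglyMeasurable (Y n) P)
    (hlim : ∀ᵐ ω ∂P, Tendsto (fun n => Y n ω) atTop (𝓝 a)) {s : Set E} (hs : s ∈ 𝓝 a) :
    Tendsto (fun n => P {ω | Y n ω ∈ s}) atTop (𝓝 1) := by
  obtain ⟨ε, hε, hsub⟩ := EMetric.mem_nhds_iff.1 hs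
  have h := tendstoInMeasure_of_tendsto_ae hY hlim ε hε
  have h1 : Tendsto (fun n => 1 - P {ω | ε ≤ edist (Y n ω) a}) atTop (𝓝 1) := by
    simpa using ENNReal.Tendsto.sub tendsto_const_nhds h (Or.inl ENNReal.one_ne_top)
  refine tendsto_of_tendsto_of_tendsto_of_le_of_le h1 tendsto_const_nhds (fun n => ?_)
    (fun n => prob_le_one)
  refine tsub_le_iff_right.2 ?_
  rw [← measure_univ (μ := P)]
  refine (measure_mono fun ω _ => ?_).trans (measure_union_le _ _)
  by_cases hω : ε ≤ edist (Y n ω) a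
  · exact Or.inr hω
  · exact Or.inl (hsub (by simpa using hω))

omit [IsProbabilityMeasure P] in
/-- Any function of the values of the empirical distribution function at finitely many points is
a random variable. -/
lemma aemeasurable_comp_empCdf {X : ℕ → Ω → ℝ} (hX : ∀ i, AEMeasurable (X i) P) {m : ℕ}
    (y : Fin m → ℝ) (n : ℕ) (Φ : (Fin m → ℝ) → ℝ) :
    AEMeasurable (fun ω => Φ fun j => empCdf (fun i => X i ω) n (y j)) P := by
  -- The empirical values depend only on a finite table of Booleans. A function on this finite space
  -- is measurable whatever `Φ` is, so nothing need be known about the measurability of `g_θ`.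
  have h : AEMeasurable (fun ω (i : Fin n) (j : Fin m) => decide (X i ω ≤ y j)) P := by
    refine aemeasurable_pi_lambda _ fun i => aemeasurable_pi_lambda _ fun j => ?_
    have : Measurable fun x : ℝ => decide (x ≤ y j) :=
      measurable_to_bool (by
        convert measurableSet_Iic (a := y j) using 1
        ext x
        simp)
    exact this.comp_aemeasurable (hX i)
  convert (measurable_of_countable fun s : Fin n → Fin m → Bool =>
    Φ fun j => (∑ i, if s i j then (1 : ℝ) else 0) / n).comp_aemeasurable h using 1
  ext ω
  simp only [empCdf, Finset.sum_range, Function.comp_apply, decide_eq_true_eq]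

end Asymptotics

/-! ### Numerator and denominator as weighted sums of increments -/

namespace GroupedTrunc

variable (D : GroupedTrunc)

lemma c_lt_c {i j : ℕ} (hij : i < j) (hj : j ≤ D.m) : D.c i < D.c j := by
  induction j, hij using Nat.le_induction with
  | base => exact D.c_lt i (by omega)
  | succ k hk ih => exact (ih (by omega)).trans (D.c_lt k (by omega))

lemma c_le_c {i j : ℕ} (hij : i ≤ j) (hj : j ≤ D.m) : D.c i ≤ D.c j := by
  rcases hij.eq_or_lt with rfl | h
  · exact le_rfl
  · exact (D.c_lt_c h hj).le

lemma c_nonneg {j : ℕ} (hj : j ≤ D.m) : 0 ≤ D.c j := by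
  simpa [D.c_zero] using D.c_le_c (Nat.zero_le j) hj

lemma l_bounds : 1 ≤ D.l ∧ D.l ≤ D.r ∧ D.r + 1 ≤ D.m := ⟨D.one_le_l, D.l_le_r, D.r_lt_m⟩

lemma c_pred_l_lt : D.c (D.l - 1) < D.c D.l := by
  have := D.l_bounds
  exact D.c_lt_c (by omega) (by omega)

lemma c_r_lt : D.c D.r < D.c (D.r + 1) := D.c_lt _ (by have := D.l_bounds; omega)

/-- The proportion of the `i`-th group interval which lies in `(t, T]`, for `l ≤ i ≤ r + 1`. -/
noncomputable def share (i : ℕ) : ℝ := if i = D.l then D.A₁ else if i = D.r + 1 then D.B₂ else 1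

/-- The midpoint of the part of the `i`-th group interval in `(t, T]`, for `l ≤ i ≤ r + 1`. -/
noncomputable def mid (i : ℕ) : ℝ :=
  if i = D.l then (D.c D.l + D.t) / 2 else if i = D.r + 1 then (D.c D.r + D.T) / 2 else D.v i

/-- The sum of the increments of a sequence over the groups that meet `(t, T]`, with weights. -/
noncomputable def wsum (w : ℕ → ℝ) (p : ℕ → ℝ) : ℝ :=
  ∑ i ∈ Finset.Icc D.l (D.r + 1), w i * (p i - p (i - 1))

lemma sum_Icc_l_r (f : ℕ → ℝ) : ∑ i ∈ Finset.Icc D.l (D.r + 1), f i =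
    f D.l + ∑ i ∈ Finset.Icc (D.l + 1) D.r, f i + f (D.r + 1) := by
  have := D.l_bounds
  rw [Finset.sum_Icc_succ_top (by omega), ← Finset.insert_Icc_succ_left_eq_Icc D.l_le_r,
    Finset.sum_insert (by simp)]
  rfl

lemma share_l : D.share D.l = D.A₁ := by simp [share]

lemma share_r : D.share (D.r + 1) = D.B₂ := by
  have := D.l_bounds
  simp [share, show D.r + 1 ≠ D.l by omega]

lemma share_of_mem {i : ℕ} (hi : i ∈ Finset.Icc (D.l + 1) D.r) : D.share i = 1 := by
  rw [Finset.mem_Icc] at hi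
  simp [share, show i ≠ D.l by omega, show i ≠ D.r + 1 by omega]

lemma mid_l : D.mid D.l = (D.c D.l + D.t) / 2 := by simp [mid]

lemma mid_r : D.mid (D.r + 1) = (D.c D.r + D.T) / 2 := by
  have := D.l_bounds
  simp [mid, show D.r + 1 ≠ D.l by omega]

lemma mid_of_mem {i : ℕ} (hi : i ∈ Finset.Icc (D.l + 1) D.r) : D.mid i = D.v i := by
  rw [Finset.mem_Icc] at hi
  simp [mid, show i ≠ D.l by omega, show i ≠ D.r + 1 by omega]

lemma share_mul_mid_l : D.share D.l * D.mid D.l = D.u := by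
  have := sub_pos.2 D.c_pred_l_lt
  rw [share_l, mid_l, A₁, u]
  field_simp
  ring

lemma share_mul_mid_r : D.share (D.r + 1) * D.mid (D.r + 1) = D.z := by
  have := sub_pos.2 D.c_r_lt
  rw [share_r, mid_r, B₂, z]
  field_simp
  ring

lemma A₁_add_B₁ : D.A₁ + D.B₁ = 1 := by
  have := sub_pos.2 D.c_pred_l_lt
  rw [A₁, B₁]
  field_simp
  ring

lemma A₂_add_B₂ : D.A₂ + D.B₂ = 1 := by
  have := sub_pos.2 D.c_r_lt
  rw [A₂, B₂]
  field_simp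
  ring

lemma A₁_nonneg : 0 ≤ D.A₁ :=
  div_nonneg (sub_nonneg.2 D.t_le) (sub_pos.2 D.c_pred_l_lt).le

lemma B₂_pos : 0 < D.B₂ := div_pos (sub_pos.2 D.lt_T) (sub_pos.2 D.c_r_lt)

lemma share_nonneg (i : ℕ) : 0 ≤ D.share i := by
  unfold share
  split_ifs
  exacts [D.A₁_nonneg, D.B₂_pos.le, zero_le_one]

lemma share_r_pos (h : D.t < D.c D.r) : 0 < D.share D.r := by
  unfold share
  split_ifs with h1 h2
  · rw [h1] at h
    exact div_pos (sub_pos.2 h) (sub_pos.2 D.c_pred_l_lt)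
  · exact D.B₂_pos
  · exact one_pos

lemma wsum_share_mul_mid (p : ℕ → ℝ) : D.wsum (fun i => D.share i * D.mid i) p =
    D.u * (p D.l - p (D.l - 1)) + ∑ i ∈ Finset.Icc (D.l + 1) D.r, D.v i * (p i - p (i - 1))
      + D.z * (p (D.r + 1) - p D.r) := by
  rw [wsum, sum_Icc_l_r, share_mul_mid_l, share_mul_mid_r, Nat.add_sub_cancel]
  congr 2
  exact Finset.sum_congr rfl fun i hi => by rw [D.share_of_mem hi, D.mid_of_mem hi, one_mul]

/-- The inner groups have weight `1` and telescope to `p r - p l`; the relations `A₁ + B₁ = 1` and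
`A₂ + B₂ = 1` absorb this into the boundary terms. -/
lemma wsum_share (p : ℕ → ℝ) : D.wsum D.share p =
    D.A₂ * p D.r + D.B₂ * p (D.r + 1) - D.A₁ * p (D.l - 1) - D.B₁ * p D.l := by
  have h : ∑ i ∈ Finset.Icc (D.l + 1) D.r, D.share i * (p i - p (i - 1)) = p D.r - p D.l := by
    rw [Finset.sum_congr rfl fun i hi => by rw [D.share_of_mem hi, one_mul]]
    have := D.l_le_r
    generalize D.r = k at this
    induction k, this using Nat.le_induction with
    | base => simp
    | succ k hk ih => rw [Finset.sum_Icc_succ_top (by omega), ih]; simp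
  rw [wsum, sum_Icc_l_r, share_l, share_r, h, Nat.add_sub_cancel]
  linear_combination p D.l * D.A₁_add_B₁ - p D.r * D.A₂_add_B₂

lemma N_eq_wsum (p : Fin D.m → ℝ) : D.N p = D.wsum (fun i => D.share i * D.mid i) (D.ext p) :=
  (D.wsum_share_mul_mid _).symm

lemma H_eq_wsum (p : Fin D.m → ℝ) : D.H p = D.wsum D.share (D.ext p) := (D.wsum_share _).symm

lemma wsum_congr (w : ℕ → ℝ) {p q : ℕ → ℝ} (h : ∀ j ≤ D.m, p j = q j) :
    D.wsum w p = D.wsum w q := by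
  have := D.l_bounds
  refine Finset.sum_congr rfl fun i hi => ?_
  rw [Finset.mem_Icc] at hi
  rw [h i (by omega), h (i - 1) (by omega)]

lemma ext_atBoundaries {G : ℝ → ℝ} (hG : G 0 = 0) {j : ℕ} (hj : j ≤ D.m) :
    D.ext (D.atBoundaries G) j = G (D.c j) := by
  cases j with
  | zero => simp [ext, D.c_zero, hG]
  | succ j => simp [ext, atBoundaries, Nat.lt_of_succ_le hj]

lemma wsum_atBoundaries (w : ℕ → ℝ) {G : ℝ → ℝ} (hG : G 0 = 0) :
    D.wsum w (D.ext (D.atBoundaries G)) = D.wsum w (fun j => G (D.c j)) :=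
  D.wsum_congr w fun _ hj => D.ext_atBoundaries hG hj

lemma sum_cell_eq {j : ℕ} (hj : j < D.m) {x : ℝ} (h1 : D.c j < x) (h2 : x ≤ D.c (j + 1))
    (f : ℕ → ℝ) :
    (∑ i ∈ Finset.range D.m, if D.c i < x ∧ x ≤ D.c (i + 1) then f i else 0) = f j := by
  rw [Finset.sum_eq_single j, if_pos ⟨h1, h2⟩]
  · intro i hi hij
    rw [Finset.mem_range] at hi
    rw [if_neg]
    rintro ⟨h3, h4⟩
    rcases lt_or_gt_of_ne hij with h | h
    · have := D.c_le_c (show i + 1 ≤ j by omega) hj.le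
      linarith
    · have := D.c_le_c (show j + 1 ≤ i by omega) hi.le
      linarith
  · intro h
    exact absurd (Finset.mem_range.2 hj) h

lemma histogram_eq {j : ℕ} (hj : j < D.m) {x : ℝ} (h1 : D.c j < x) (h2 : x ≤ D.c (j + 1))
    (G : ℝ → ℝ) :
    D.histogram G x = (G (D.c (j + 1)) - G (D.c j)) / (D.c (j + 1) - D.c j) :=
  D.sum_cell_eq hj h1 h2 _

lemma ogive_eq {j : ℕ} (hj : j < D.m) {x : ℝ} (h1 : D.c j ≤ x) (h2 : x ≤ D.c (j + 1))
    {G : ℝ → ℝ} (hG : G 0 = 0) :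
    D.ogive G x = (D.c (j + 1) - x) / (D.c (j + 1) - D.c j) * G (D.c j)
      + (x - D.c j) / (D.c (j + 1) - D.c j) * G (D.c (j + 1)) := by
  rcases h1.lt_or_eq with h | rfl
  · exact D.sum_cell_eq hj h h2 _
  -- A left endpoint belongs to the preceding cell, where interpolation gives the same value. At `c
  -- 0 = 0` there is no such cell and the ogive is `0`, which is why `G 0 = 0` is required.
  have hd := sub_pos.2 (D.c_lt j hj)
  rw [sub_self, zero_div, zero_mul, add_zero, div_self hd.ne', one_mul]
  cases j with
  | zero =>
    rw [D.c_zero, hG]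
    refine Finset.sum_eq_zero fun i hi => if_neg fun h => ?_
    have := D.c_nonneg (Finset.mem_range.1 hi).le
    linarith [h.1]
  | succ k =>
    have hd' := sub_pos.2 (D.c_lt k (by omega))
    refine (D.sum_cell_eq (by omega) (D.c_lt k (by omega)) le_rfl _).trans ?_
    simp [hd'.ne']

lemma integral_histogram_cell {j : ℕ} (hj : j < D.m) {a b : ℝ} (h1 : D.c j ≤ a) (hab : a ≤ b)
    (h2 : b ≤ D.c (j + 1)) (G : ℝ → ℝ) :
    IntervalIntegrable (fun x => x * D.histogram G x) volume a b ∧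
    ∫ x in a..b, x * D.histogram G x = (b ^ 2 - a ^ 2) / (2 * (D.c (j + 1) - D.c j))
      * (G (D.c (j + 1)) - G (D.c j)) := by
  set κ := (G (D.c (j + 1)) - G (D.c j)) / (D.c (j + 1) - D.c j) with hκ
  have h : Set.EqOn (fun x => x * κ) (fun x => x * D.histogram G x) (Set.uIoc a b) := by
    intro x hx
    rw [Set.uIoc_of_le hab] at hx
    simp only
    rw [D.histogram_eq hj (h1.trans_lt hx.1) (hx.2.trans h2)]
  refine ⟨(Continuous.intervalIntegrable (by fun_prop) a b).congr h, ?_⟩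
  rw [← intervalIntegral.integral_congr_ae (Eventually.of_forall h),
    intervalIntegral.integral_mul_const, integral_id, hκ]
  have hd := sub_pos.2 (D.c_lt j hj)
  field_simp

lemma integral_histogram (G : ℝ → ℝ) :
    ∫ x in D.t..D.T, x * D.histogram G x = D.wsum (fun i => D.share i * D.mid i)
      (fun j => G (D.c j)) := by
  have hb := D.l_bounds
  have e1 := D.integral_histogram_cell (j := D.l - 1) (by omega) D.le_t D.t_le
    (by rw [Nat.sub_add_cancel hb.1]) G
  rw [Nat.sub_add_cancel hb.1] at e1
  have e3 := D.integral_histogram_cell (j := D.r) (by omega) le_rfl D.lt_T.le D.T_le G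
  -- The full cells between `c l` and `c r`, by induction on the right end.
  have e2 : IntervalIntegrable (fun x => x * D.histogram G x) volume (D.c D.l) (D.c D.r) ∧
      ∫ x in D.c D.l..D.c D.r, x * D.histogram G x =
        ∑ i ∈ Finset.Icc (D.l + 1) D.r, D.v i * (G (D.c i) - G (D.c (i - 1))) := by
    have hr : D.r ≤ D.m := by omega
    have := D.l_le_r
    generalize D.r = k at this hr
    induction k, this using Nat.le_induction with
    | base => simp
    | succ k hk ih =>
      obtain ⟨i1, i2⟩ := ih (by omega)
      have h := D.integral_histogram_cell (j := k) (by omega) le_rfl (D.c_lt k (by omega)).le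
        le_rfl G
      refine ⟨i1.trans h.1, ?_⟩
      rw [← intervalIntegral.integral_add_adjacent_intervals i1 h.1, i2,
        Finset.sum_Icc_succ_top (by omega), h.2]
      have hd := sub_pos.2 (D.c_lt k (by omega))
      simp only [v, Nat.add_sub_cancel]
      field_simp
      ring
  rw [← intervalIntegral.integral_add_adjacent_intervals (e1.1.trans e2.1) e3.1,
    ← intervalIntegral.integral_add_adjacent_intervals e1.1 e2.1, e1.2, e2.2, e3.2,
    wsum_share_mul_mid]
  rfl

lemma ogive_T_sub_ogive_t {G : ℝ → ℝ} (hG : G 0 = 0) :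
    D.ogive G D.T - D.ogive G D.t = D.wsum D.share (fun j => G (D.c j)) := by
  have hb := D.l_bounds
  rw [D.ogive_eq (j := D.r) (by omega) D.lt_T.le D.T_le hG,
    D.ogive_eq (j := D.l - 1) (by omega) D.le_t (by rw [Nat.sub_add_cancel hb.1]; exact D.t_le) hG,
    wsum_share, Nat.sub_add_cancel hb.1, A₁, B₁, A₂, B₂]
  ring

lemma truncMean_eq_gMu {G : ℝ → ℝ} (hG : G 0 = 0) :
    D.truncMean G = D.gMu (D.atBoundaries G) := by
  rw [truncMean, gMu, integral_histogram, ogive_T_sub_ogive_t _ hG, N_eq_wsum, H_eq_wsum,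
    wsum_atBoundaries _ _ hG, wsum_atBoundaries _ _ hG]

/-! ### Partial derivatives of `g_μ` -/

lemma ext_update (p : Fin D.m → ℝ) (j : Fin D.m) (s : ℝ) (k : ℕ) :
    D.ext (Function.update p j s) k = D.ext p k + (s - p j) * (if k = j + 1 then 1 else 0) := by
  cases k with
  | zero => simp [ext]
  | succ k =>
    by_cases hk : k < D.m
    · by_cases hkj : k = j
      · subst hkj
        simp [ext]
      · have : (⟨k, hk⟩ : Fin D.m) ≠ j := fun h => hkj (by rw [← h])
        simp [ext, hk, hkj, Function.update_of_ne this]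
    · have : k ≠ j := fun h => hk (h ▸ j.2)
      simp [ext, hk, this]

/-- The sequence with the value `1` at `k` and `0` elsewhere. -/
def unitSeq (k : ℕ) : ℕ → ℝ := fun i => if i = k then 1 else 0

lemma wsum_add_mul (w p q : ℕ → ℝ) (a : ℝ) :
    D.wsum w (fun i => p i + a * q i) = D.wsum w p + a * D.wsum w q := by
  simp only [wsum, Finset.mul_sum, ← Finset.sum_add_distrib]
  exact Finset.sum_congr rfl fun i _ => by ring

/-- A weighted sum is affine in each coordinate. The slope is its value on a unit sequence at `j +
1`, because coordinate `j : Fin m` stands for `p_{j+1}`. -/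
lemma wsum_ext_update (w : ℕ → ℝ) (p : Fin D.m → ℝ) (j : Fin D.m) (s : ℝ) :
    D.wsum w (D.ext (Function.update p j s)) =
      D.wsum w (D.ext p) + (s - p j) * D.wsum w (unitSeq (j + 1)) := by
  rw [← wsum_add_mul]
  exact D.wsum_congr w fun k _ => D.ext_update p j s k

lemma hasDerivAt_gMu_update {p : Fin D.m → ℝ} (hp : D.H p ≠ 0) (j : Fin D.m) :
    HasDerivAt (fun s => D.gMu (Function.update p j s))
      ((D.wsum (fun i => D.share i * D.mid i) (unitSeq (j + 1)) * D.H p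
        - D.N p * D.wsum D.share (unitSeq (j + 1))) / D.H p ^ 2) (p j) := by
  have h (w : ℕ → ℝ) : HasDerivAt (fun s => D.wsum w (D.ext (Function.update p j s)))
      (D.wsum w (unitSeq (j + 1))) (p j) := by
    simp only [wsum_ext_update]
    simpa using (((hasDerivAt_id (p j)).sub_const (p j)).mul_const
      (D.wsum w (unitSeq (j + 1)))).const_add (D.wsum w (D.ext p))
  have := (h (fun i => D.share i * D.mid i)).div (h D.share) (by
    rw [← H_eq_wsum, Function.update_eq_self]; exact hp)
  simp only [← H_eq_wsum, ← N_eq_wsum, Function.update_eq_self] at this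
  exact this

lemma sum_v_mul_unitSeq (k : ℕ) :
    ∑ i ∈ Finset.Icc (D.l + 1) D.r, D.v i * (unitSeq k i - unitSeq k (i - 1)) =
      (if D.l + 1 ≤ k ∧ k ≤ D.r then D.v k else 0)
        - (if D.l ≤ k ∧ k + 1 ≤ D.r then D.v (k + 1) else 0) := by
  simp only [mul_sub, Finset.sum_sub_distrib]
  congr 1
  · simp [unitSeq]
  · have : ∀ i ∈ Finset.Icc (D.l + 1) D.r, D.v i * unitSeq k (i - 1) =
        if i = k + 1 then D.v (k + 1) else 0 := by
      intro i hi
      rw [Finset.mem_Icc] at hi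
      by_cases h : i = k + 1
      · simp [unitSeq, h]
      · simp [unitSeq, h, show i - 1 ≠ k by omega]
    rw [Finset.sum_congr rfl this]
    simp

lemma partial_eq_of_lt (hlr : D.l < D.r) {p : Fin D.m → ℝ} (hp : D.H p ≠ 0) {k : ℕ} (hk : 1 ≤ k) :
    (D.wsum (fun i => D.share i * D.mid i) (unitSeq k) * D.H p
        - D.N p * D.wsum D.share (unitSeq k)) / D.H p ^ 2 = D.partialLt p k := by
  have hb := D.l_bounds
  rw [wsum_share_mul_mid, wsum_share, sum_v_mul_unitSeq, partialLt]
  rcases lt_or_ge (k + 1) D.l with h | h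
  · simp (disch := omega) only [unitSeq, if_neg]
    ring
  rcases h.eq_or_lt with h | h
  · simp (disch := omega) only [unitSeq, if_neg, if_pos]
    ring
  rcases eq_or_ne k D.l with rfl | h'
  · simp (disch := omega) only [unitSeq, if_neg, if_pos, if_true]
    ring
  rcases lt_or_ge k D.r with h2 | h2
  -- Strictly between `l` and `r` only `N` depends on `p_k`, with slope `v k - v (k + 1) = (c (k -
  -- 1) - c (k + 1)) / 2`; one factor `H` cancels.
  · simp (disch := omega) only [unitSeq, if_neg, if_pos, v, Nat.add_sub_cancel]
    field_simp
    ring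
  rcases h2.eq_or_lt with h2 | h2
  · rw [← h2]
    simp (disch := omega) only [unitSeq, if_neg, if_pos, if_true]
    ring
  rcases eq_or_ne k (D.r + 1) with rfl | h3
  · simp (disch := omega) only [unitSeq, if_neg, if_true]
    ring
  · simp (disch := omega) only [unitSeq, if_neg]
    ring

lemma partial_eq_of_eq (hlr : D.l = D.r) {p : Fin D.m → ℝ} {k : ℕ} (hk : 1 ≤ k) :
    (D.wsum (fun i => D.share i * D.mid i) (unitSeq k) * D.H p
        - D.N p * D.wsum D.share (unitSeq k)) / D.H p ^ 2 = D.partialEq p k := by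
  have hb := D.l_bounds
  rw [wsum_share_mul_mid, wsum_share, sum_v_mul_unitSeq, partialEq, ← hlr]
  rcases eq_or_ne (k + 1) D.l with h | h
  · simp (disch := omega) only [unitSeq, if_neg, if_pos]
    ring
  rcases eq_or_ne k D.l with rfl | h'
  · simp (disch := omega) only [unitSeq, if_neg, if_true]
    ring
  rcases eq_or_ne k (D.l + 1) with rfl | h3
  · simp (disch := omega) only [unitSeq, if_neg, if_true]
    ring
  · simp (disch := omega) only [unitSeq, if_neg]
    ring

end GroupedTrunc

/-! ### The exponential distribution function and Chebyshev's inequality -/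

lemma expCdf_eq {θ : ℝ} (hθ : 0 < θ) {x : ℝ} (hx : 0 ≤ x) :
    expCdf θ x = 1 - Real.exp (-x / θ) := by
  rw [expCdf, cdf_expMeasure_eq (inv_pos.2 hθ), if_pos hx, neg_div, div_eq_inv_mul]

lemma expCdf_zero {θ : ℝ} (hθ : 0 < θ) : expCdf θ 0 = 0 := by
  simp [expCdf_eq hθ le_rfl]

lemma strictMonoOn_expCdf {θ : ℝ} (hθ : 0 < θ) : StrictMonoOn (expCdf θ) (Set.Ici 0) := by
  intro x hx y hy hxy
  rw [expCdf_eq hθ hx, expCdf_eq hθ hy]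
  have : -y / θ < -x / θ := by gcongr
  linarith [Real.exp_lt_exp.2 this]

/-- A strict form of Chebyshev's sum inequality, for weights `α` and functions `x` and `q' / q`
that are strictly increasing. -/
lemma chebyshev_sum_sub_pos {s : Finset ℕ} {α x q q' : ℕ → ℝ} (hα : ∀ i ∈ s, 0 ≤ α i)
    (hlt : ∀ i ∈ s, ∀ k ∈ s, i < k → x i < x k ∧ q' i * q k < q i * q' k)
    (hex : ∃ i ∈ s, ∃ k ∈ s, i < k ∧ 0 < α i ∧ 0 < α k) :
    0 < (∑ i ∈ s, α i * x i * q' i) * (∑ i ∈ s, α i * q i)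
      - (∑ i ∈ s, α i * x i * q i) * (∑ i ∈ s, α i * q' i) := by
  -- Symmetrization over pairs: twice the difference is the sum of `f i k`, whose two factors have
  -- the same sign when `i ≠ k`.
  set f : ℕ → ℕ → ℝ := fun i k => α i * α k * ((x k - x i) * (q i * q' k - q' i * q k)) with hf
  have hff : ∀ i k, f i k = (α k * x k * q' k) * (α i * q i) - (α k * x k * q k) * (α i * q' i)
      + ((α i * x i * q' i) * (α k * q k) - (α i * x i * q i) * (α k * q' k)) := by
    intro i k
    simp only [hf]
    ring
  have hsum : 2 * ((∑ i ∈ s, α i * x i * q' i) * (∑ i ∈ s, α i * q i)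
      - (∑ i ∈ s, α i * x i * q i) * (∑ i ∈ s, α i * q' i)) = ∑ i ∈ s, ∑ k ∈ s, f i k := by
    simp only [hff, Finset.sum_add_distrib, Finset.sum_sub_distrib]
    rw [Finset.sum_comm (f := fun i k => (α k * x k * q' k) * (α i * q i)),
      Finset.sum_comm (f := fun i k => (α k * x k * q k) * (α i * q' i))]
    simp only [← Finset.sum_mul_sum]
    ring
  have hpos : ∀ i ∈ s, ∀ k ∈ s, i ≠ k → 0 < (x k - x i) * (q i * q' k - q' i * q k) := by
    intro i hi k hk hik
    rcases lt_or_gt_of_ne hik with h | h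
    · obtain ⟨h1, h2⟩ := hlt i hi k hk h
      exact mul_pos (sub_pos.2 h1) (sub_pos.2 h2)
    · obtain ⟨h1, h2⟩ := hlt k hk i hi h
      exact mul_pos_of_neg_of_neg (sub_neg.2 h1) (by linarith)
  have hnn : ∀ i ∈ s, ∀ k ∈ s, 0 ≤ f i k := by
    intro i hi k hk
    rcases eq_or_ne i k with rfl | h
    · simp [hf]
    · exact mul_nonneg (mul_nonneg (hα i hi) (hα k hk)) (hpos i hi k hk h).le
  obtain ⟨i, hi, k, hk, hik, h1, h2⟩ := hex
  have : 0 < ∑ i ∈ s, ∑ k ∈ s, f i k :=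
    Finset.sum_pos' (fun i hi => Finset.sum_nonneg (hnn i hi))
      ⟨i, hi, Finset.sum_pos' (hnn i hi) ⟨k, hk, mul_pos (mul_pos h1 h2) (hpos i hi k hk hik.ne)⟩⟩
  linarith

/-! ### Monotonicity of `g_{tT}` and its inverse function -/

namespace GroupedTrunc

variable (D : GroupedTrunc)

lemma wsum_expCdf (w : ℕ → ℝ) {θ : ℝ} (hθ : 0 < θ) :
    D.wsum w (fun j => expCdf θ (D.c j)) = D.wsum w (fun j => 1 - D.e j θ) :=
  D.wsum_congr w fun _ hj => expCdf_eq hθ (D.c_nonneg hj)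

lemma wsum_Fvec (w : ℕ → ℝ) {θ : ℝ} (hθ : 0 < θ) :
    D.wsum w (D.ext (D.Fvec θ)) = D.wsum w (fun j => 1 - D.e j θ) := by
  rw [Fvec, wsum_atBoundaries _ _ (expCdf_zero hθ), wsum_expCdf _ _ hθ]

lemma e_lt_e {θ : ℝ} (hθ : 0 < θ) {i j : ℕ} (hij : i < j) (hj : j ≤ D.m) : D.e j θ < D.e i θ := by
  have := D.c_lt_c hij hj
  exact Real.exp_lt_exp.2 (by gcongr)

lemma wsum_share_e_pos {θ : ℝ} (hθ : 0 < θ) : 0 < D.wsum D.share (fun j => 1 - D.e j θ) := by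
  have hb := D.l_bounds
  have h : ∀ i ∈ Finset.Icc D.l (D.r + 1), 0 < (1 - D.e i θ) - (1 - D.e (i - 1) θ) := by
    intro i hi
    rw [Finset.mem_Icc] at hi
    linarith [D.e_lt_e hθ (show i - 1 < i by omega) (show i ≤ D.m by omega)]
  exact Finset.sum_pos' (fun i hi => mul_nonneg (D.share_nonneg i) (h i hi).le)
    ⟨D.r + 1, by simp; omega, mul_pos (by rw [share_r]; exact D.B₂_pos) (h _ (by simp; omega))⟩

lemma H_Fvec_pos {θ : ℝ} (hθ : 0 < θ) : 0 < D.H (D.Fvec θ) := by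
  rw [H_eq_wsum, wsum_Fvec _ _ hθ]
  exact D.wsum_share_e_pos hθ

lemma gtT_eq_gMu {θ : ℝ} (hθ : 0 < θ) : D.gtT θ = D.gMu (D.Fvec θ) :=
  D.truncMean_eq_gMu (expCdf_zero hθ)

lemma gtT_eq_div {θ : ℝ} (hθ : 0 < θ) : D.gtT θ =
    D.wsum (fun i => D.share i * D.mid i) (fun j => 1 - D.e j θ)
      / D.wsum D.share (fun j => 1 - D.e j θ) := by
  rw [gtT_eq_gMu _ hθ, gMu, N_eq_wsum, H_eq_wsum, wsum_Fvec _ _ hθ, wsum_Fvec _ _ hθ]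

lemma hasStrictDerivAt_e (j : ℕ) {θ : ℝ} (hθ : 0 < θ) :
    HasStrictDerivAt (D.e j) (D.c j / θ ^ 2 * D.e j θ) θ := by
  have h := ((hasStrictDerivAt_const θ (-D.c j)).div (hasStrictDerivAt_id θ) hθ.ne').exp
  refine h.congr_deriv ?_
  simp only [e, Pi.div_apply, id]
  ring

lemma hasStrictDerivAt_wsum (w : ℕ → ℝ) {θ : ℝ} (hθ : 0 < θ) :
    HasStrictDerivAt (fun θ => D.wsum w (fun j => 1 - D.e j θ))
      (D.wsum w (fun j => -(D.c j / θ ^ 2 * D.e j θ))) θ :=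
  HasStrictDerivAt.fun_sum fun i _ =>
    (((D.hasStrictDerivAt_e i hθ).const_sub 1).sub
      ((D.hasStrictDerivAt_e (i - 1) hθ).const_sub 1)).const_mul (w i)

/-- After adding `θ` times the difference of exponentials, this says that the mean of the
exponential law conditioned on `(a, b]` lies strictly between `a` and `b`. Both bounds come from `1
+ x < exp x` at `x = ±(b - a) / θ`. -/
lemma score_bounds {θ : ℝ} (hθ : 0 < θ) {a b : ℝ} (hab : a < b) :
    (a - θ) * (Real.exp (-a / θ) - Real.exp (-b / θ)) <
        a * Real.exp (-a / θ) - b * Real.exp (-b / θ) ∧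
      a * Real.exp (-a / θ) - b * Real.exp (-b / θ) <
        (b - θ) * (Real.exp (-a / θ) - Real.exp (-b / θ)) := by
  have hd : 0 < (b - a) / θ := div_pos (sub_pos.2 hab) hθ
  have hba : θ * ((b - a) / θ) = b - a := by field_simp
  have h1 : Real.exp (-a / θ) = Real.exp (-b / θ) * Real.exp ((b - a) / θ) := by
    rw [← Real.exp_add]
    ring_nf
  have h2 : Real.exp (-b / θ) = Real.exp (-a / θ) * Real.exp (-((b - a) / θ)) := by
    rw [← Real.exp_add]
    ring_nf
  have k1 := mul_lt_mul_of_pos_left (Real.add_one_lt_exp hd.ne')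
    (mul_pos hθ (Real.exp_pos (-b / θ)))
  have k2 := mul_lt_mul_of_pos_left (Real.add_one_lt_exp (neg_ne_zero.2 hd.ne'))
    (mul_pos hθ (Real.exp_pos (-a / θ)))
  rw [mul_assoc θ _ (Real.exp ((b - a) / θ)), ← h1] at k1
  rw [mul_assoc θ _ (Real.exp (-((b - a) / θ))), ← h2] at k2
  constructor
  · linear_combination k1 - Real.exp (-b / θ) * hba
  · linear_combination k2 + Real.exp (-a / θ) * hba

lemma mid_le {i : ℕ} (hi : i ∈ Finset.Icc D.l D.r) : D.mid i ≤ D.c i := by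
  have hb := D.l_bounds
  rw [Finset.mem_Icc] at hi
  by_cases h : i = D.l
  · rw [h, mid_l]
    linarith [D.t_le]
  · rw [D.mid_of_mem (by simp; omega), v]
    linarith [D.c_le_c (Nat.sub_le i 1) (show i ≤ D.m by omega)]

lemma lt_mid {i : ℕ} (hi : i ∈ Finset.Icc (D.l + 1) (D.r + 1)) : D.c (i - 1) < D.mid i := by
  have hb := D.l_bounds
  rw [Finset.mem_Icc] at hi
  by_cases h : i = D.r + 1
  · rw [h, mid_r, Nat.add_sub_cancel]
    linarith [D.lt_T]
  · rw [D.mid_of_mem (by simp; omega), v]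
    linarith [D.c_lt_c (show i - 1 < i by omega) (show i ≤ D.m by omega)]

/-- The chain `mid i ≤ c i ≤ c (k - 1) < mid k`. The first inequality can be an equality, when `i =
l` and `t = c l`; strictness comes from the last. -/
lemma mid_lt_mid {i k : ℕ} (hi : D.l ≤ i) (hik : i < k) (hk : k ≤ D.r + 1) :
    D.mid i < D.mid k := by
  have hb := D.l_bounds
  exact (D.mid_le (by simp; omega)).trans_lt
    ((D.c_le_c (by omega) (by omega)).trans_lt (D.lt_mid (by simp; omega)))

/-- The numerator of the derivative of `g_{tT}` is positive. -/
lemma wsum_wronskian_pos (h : D.t < D.c D.r) {θ : ℝ} (hθ : 0 < θ) :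
    0 < D.wsum (fun i => D.share i * D.mid i) (fun j => -(D.c j / θ ^ 2 * D.e j θ))
          * D.wsum D.share (fun j => 1 - D.e j θ)
        - D.wsum (fun i => D.share i * D.mid i) (fun j => 1 - D.e j θ)
          * D.wsum D.share (fun j => -(D.c j / θ ^ 2 * D.e j θ)) := by
  have hb := D.l_bounds
  -- Groups `r` and `r + 1` both carry positive weight: the first because `t < c r`, the second
  -- because `c r < T`.
  refine chebyshev_sum_sub_pos (fun i _ => D.share_nonneg i) (fun i hi k hk hik => ?_)
    ⟨D.r, by simp; omega, D.r + 1, by simp; omega, by simp, D.share_r_pos h,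
      by rw [share_r]; exact D.B₂_pos⟩
  rw [Finset.mem_Icc] at hi hk
  refine ⟨D.mid_lt_mid hi.1 hik hk.2, ?_⟩
  have si := (score_bounds hθ (D.c_lt_c (show i - 1 < i by omega) (show i ≤ D.m by omega))).2
  have sk := (score_bounds hθ (D.c_lt_c (show k - 1 < k by omega) (show k ≤ D.m by omega))).1
  have qi := sub_pos.2 (D.e_lt_e hθ (show i - 1 < i by omega) (show i ≤ D.m by omega))
  have qk := sub_pos.2 (D.e_lt_e hθ (show k - 1 < k by omega) (show k ≤ D.m by omega))
  change _ < (D.c i - θ) * (D.e (i - 1) θ - D.e i θ) at si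
  change (D.c (k - 1) - θ) * (D.e (k - 1) θ - D.e k θ) < _ at sk
  have hc := D.c_le_c (show i ≤ k - 1 by omega) (show k - 1 ≤ D.m by omega)
  have h1 := mul_lt_mul_of_pos_right si qk
  have h2 := mul_lt_mul_of_pos_right sk qi
  have h3 := mul_le_mul_of_nonneg_right hc (mul_pos qi qk).le
  -- The conditional mean of group `i` is below `c i ≤ c (k - 1)`, and that of group `k` is above.
  have h4 : (D.c (i - 1) * D.e (i - 1) θ - D.c i * D.e i θ) * (D.e (k - 1) θ - D.e k θ)
      < (D.c (k - 1) * D.e (k - 1) θ - D.c k * D.e k θ) * (D.e (i - 1) θ - D.e i θ) := by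
    simp only [e] at *
    linarith
  have h5 := mul_lt_mul_of_pos_right h4 (inv_pos.2 (pow_pos hθ 2))
  calc _ = (D.c (i - 1) * D.e (i - 1) θ - D.c i * D.e i θ) * (D.e (k - 1) θ - D.e k θ)
        * (θ ^ 2)⁻¹ := by ring
    _ < _ := h5
    _ = _ := by ring

lemma cA_sub_cB (θ : ℝ) : D.cA - D.cB θ = D.wsum D.share (fun j => 1 - D.e j θ) := by
  rw [wsum_share, cA, cB]
  ring

lemma cGamma_eq (θ : ℝ) : D.cGamma θ =
    D.wsum (fun i => D.share i * D.mid i) (fun j => -(D.c j / θ ^ 2 * D.e j θ)) := by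
  rw [wsum_share_mul_mid, cGamma, cLambda,
    Finset.sum_congr rfl fun i _ => show
      D.v i / θ ^ 2 * (D.c (i - 1) * D.e (i - 1) θ - D.c i * D.e i θ) =
      D.v i * (-(D.c i / θ ^ 2 * D.e i θ) - -(D.c (i - 1) / θ ^ 2 * D.e (i - 1) θ)) by ring]
  ring

lemma cDelta_eq (θ μ : ℝ) : D.cDelta θ μ =
    -(μ * D.wsum D.share (fun j => -(D.c j / θ ^ 2 * D.e j θ))) := by
  rw [wsum_share, cDelta]
  ring

lemma cLambda_eq_cGamma (h : D.l = D.r) (θ : ℝ) : D.cLambda θ = D.cGamma θ := by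
  rw [cGamma, ← h]
  simp

/-- `Γ` is the `θ`-derivative of the numerator and `Δ` is `-μ` times that of the denominator, so
with `μ` the quotient the sum is `(N' H - N H') / H`. -/
lemma cGamma_add_cDelta {θ : ℝ} (hθ : 0 < θ) : D.cGamma θ + D.cDelta θ (D.gtT θ) =
    (D.wsum (fun i => D.share i * D.mid i) (fun j => -(D.c j / θ ^ 2 * D.e j θ))
          * D.wsum D.share (fun j => 1 - D.e j θ)
        - D.wsum (fun i => D.share i * D.mid i) (fun j => 1 - D.e j θ)
          * D.wsum D.share (fun j => -(D.c j / θ ^ 2 * D.e j θ)))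
      / D.wsum D.share (fun j => 1 - D.e j θ) := by
  have := D.wsum_share_e_pos hθ
  rw [cGamma_eq, cDelta_eq, gtT_eq_div _ hθ]
  field_simp
  ring

lemma cGamma_add_cDelta_pos (h : D.t < D.c D.r) {θ : ℝ} (hθ : 0 < θ) :
    0 < D.cGamma θ + D.cDelta θ (D.gtT θ) := by
  rw [cGamma_add_cDelta _ hθ]
  exact div_pos (D.wsum_wronskian_pos h hθ) (D.wsum_share_e_pos hθ)

lemma cA_sub_cB_pos {θ : ℝ} (hθ : 0 < θ) : 0 < D.cA - D.cB θ := by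
  rw [cA_sub_cB]
  exact D.wsum_share_e_pos hθ

lemma hasStrictDerivAt_gtT {θ : ℝ} (hθ : 0 < θ) :
    HasStrictDerivAt D.gtT ((D.cGamma θ + D.cDelta θ (D.gtT θ)) / (D.cA - D.cB θ)) θ := by
  have hH := D.wsum_share_e_pos hθ
  have h := (D.hasStrictDerivAt_wsum (fun i => D.share i * D.mid i) hθ).div
    (D.hasStrictDerivAt_wsum D.share hθ) hH.ne'
  rw [cGamma_add_cDelta _ hθ, cA_sub_cB, div_div, ← sq]
  refine h.congr_of_eventuallyEq ?_
  filter_upwards [lt_mem_nhds hθ] with x hx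
  exact (D.gtT_eq_div hx).symm

lemma strictMonoOn_gtT (h : D.t < D.c D.r) : StrictMonoOn D.gtT (Set.Ioi 0) := by
  refine strictMonoOn_of_deriv_pos (convex_Ioi 0) (fun x hx =>
    (D.hasStrictDerivAt_gtT hx).hasDerivAt.continuousAt.continuousWithinAt) fun x hx => ?_
  rw [interior_Ioi] at hx
  rw [(D.hasStrictDerivAt_gtT hx).hasDerivAt.deriv]
  exact div_pos (D.cGamma_add_cDelta_pos h hx) (D.cA_sub_cB_pos hx)

lemma gTheta_gtT (h : D.t < D.c D.r) {θ : ℝ} (hθ : 0 < θ) : D.gTheta (D.gtT θ) = θ :=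
  (D.strictMonoOn_gtT h).injOn.leftInvOn_invFunOn hθ

lemma hasDerivAt_gTheta (h : D.t < D.c D.r) {θ : ℝ} (hθ : 0 < θ) :
    HasDerivAt D.gTheta ((D.cA - D.cB θ) / (D.cGamma θ + D.cDelta θ (D.gtT θ))) (D.gtT θ) := by
  have hne := div_pos (D.cGamma_add_cDelta_pos h hθ) (D.cA_sub_cB_pos hθ)
  have key := (D.hasStrictDerivAt_gtT hθ).to_local_left_inverse hne.ne' (g := D.gTheta) (by
    filter_upwards [lt_mem_nhds hθ] with x hx
    exact D.gTheta_gtT h hx)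
  rw [inv_div] at key
  exact key.hasDerivAt

/-- A nonzero strict derivative makes the map locally open. This ensures that `μ̂`, once close to
`μ`, lies in the range of `g_{tT}`. -/
lemma image_gtT_mem_nhds (h : D.t < D.c D.r) {θ : ℝ} (hθ : 0 < θ) :
    D.gtT '' Set.Ioi 0 ∈ 𝓝 (D.gtT θ) := by
  have hne := div_pos (D.cGamma_add_cDelta_pos h hθ) (D.cA_sub_cB_pos hθ)
  rw [← (D.hasStrictDerivAt_gtT hθ).map_nhds_eq hne.ne']
  exact image_mem_map (Ioi_mem_nhds hθ)

end GroupedTrunc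

/-! ### Contribution of one observation, and the variance -/

namespace GroupedTrunc

variable (D : GroupedTrunc)

/-- The contribution of a single observation to a weighted sum of the increments of the empirical
distribution function. -/
noncomputable def contrib (w : ℕ → ℝ) (x : ℝ) : ℝ :=
  D.wsum w (D.ext (D.atBoundaries fun y => if x ≤ y then 1 else 0))

lemma wsum_ext_eq_sum (w : ℕ → ℝ) (p : Fin D.m → ℝ) :
    D.wsum w (D.ext p) = ∑ j : Fin D.m, p j * D.wsum w (unitSeq (j + 1)) := by
  have h : ∀ k, D.ext p k = ∑ j : Fin D.m, p j * unitSeq (j + 1) k := by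
    intro k
    cases k with
    | zero => simp [ext, unitSeq]
    | succ k =>
      by_cases hk : k < D.m
      · rw [Finset.sum_eq_single ⟨k, hk⟩]
        · simp [ext, unitSeq, hk]
        · intro j _ hj
          have : k ≠ j := fun h => hj (by ext; exact h.symm)
          simp [unitSeq, this]
        · simp
      · rw [Finset.sum_eq_zero]
        · simp [ext, hk]
        · intro j _
          have : k ≠ j := fun h => hk (h ▸ j.2)
          simp [unitSeq, this]
  simp only [wsum, h, ← Finset.sum_sub_distrib, Finset.mul_sum]
  rw [Finset.sum_comm]
  exact Finset.sum_congr rfl fun j _ => Finset.sum_congr rfl fun i _ => by ring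

lemma contrib_eq_sum (w : ℕ → ℝ) (x : ℝ) : D.contrib w x =
    ∑ j : Fin D.m, (Set.Iic (D.c (j + 1))).indicator 1 x * D.wsum w (unitSeq (j + 1)) := by
  rw [contrib, wsum_ext_eq_sum]
  simp [atBoundaries, Set.indicator_apply]

lemma measurable_contrib (w : ℕ → ℝ) : Measurable (D.contrib w) := by
  simp only [funext (D.contrib_eq_sum w)]
  exact Finset.measurable_sum _ fun j _ =>
    (measurable_one.indicator measurableSet_Iic).mul_const _

lemma wsum_empCdf (w : ℕ → ℝ) (x : ℕ → ℝ) (n : ℕ) :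
    D.wsum w (D.ext (D.atBoundaries (empCdf x n))) =
      (∑ i ∈ Finset.range n, D.contrib w (x i)) / n := by
  simp only [contrib_eq_sum, wsum_ext_eq_sum, atBoundaries, empCdf]
  rw [Finset.sum_comm, Finset.sum_div]
  refine Finset.sum_congr rfl fun j _ => ?_
  rw [← Finset.sum_mul, div_mul_eq_mul_div]
  simp [Set.indicator_apply]

section Measure

variable (w : ℕ → ℝ) (ν : Measure ℝ) [IsProbabilityMeasure ν]

lemma memLp_contrib (q : ENNReal) : MemLp (D.contrib w) q ν := by
  simp only [funext (D.contrib_eq_sum w)]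
  refine memLp_finsetSum _ fun j _ => MemLp.mul_const ?_ _
  exact (memLp_const (1 : ℝ)).indicator measurableSet_Iic

lemma integral_contrib : ∫ x, D.contrib w x ∂ν = D.wsum w (D.ext (D.atBoundaries (cdf ν))) := by
  simp only [contrib_eq_sum, wsum_ext_eq_sum]
  rw [integral_finsetSum]
  · refine Finset.sum_congr rfl fun j _ => ?_
    rw [integral_mul_const, integral_indicator_one measurableSet_Iic, atBoundaries, cdf_eq_real]
  · exact fun j _ => ((integrable_const (1 : ℝ)).indicator measurableSet_Iic).mul_const _

lemma integral_contrib_sq : ∫ x, D.contrib w x ^ 2 ∂ν =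
    ∑ j : Fin D.m, ∑ k : Fin D.m, D.atBoundaries (cdf ν) (min j k) *
      (D.wsum w (unitSeq (j + 1)) * D.wsum w (unitSeq (k + 1))) := by
  have h : ∀ x, D.contrib w x ^ 2 = ∑ j : Fin D.m, ∑ k : Fin D.m,
      (Set.Iic (D.c ((min j k : Fin D.m) + 1))).indicator 1 x *
      (D.wsum w (unitSeq (j + 1)) * D.wsum w (unitSeq (k + 1))) := by
    intro x
    rw [contrib_eq_sum, sq, Finset.sum_mul_sum]
    refine Finset.sum_congr rfl fun j _ => Finset.sum_congr rfl fun k _ => ?_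
    have : Set.Iic (D.c ((min j k : Fin D.m) + 1)) =
        Set.Iic (D.c (j + 1)) ∩ Set.Iic (D.c (k + 1)) := by
      rw [Set.Iic_inter_Iic]
      rcases le_total j k with hjk | hjk
      · rw [min_eq_left hjk, inf_eq_left.2 (D.c_le_c (by simpa using hjk) k.2)]
      · rw [min_eq_right hjk, inf_eq_right.2 (D.c_le_c (by simpa using hjk) j.2)]
    rw [this, Set.inter_indicator_one, Pi.mul_apply]
    ring
  have hi : ∀ j k : Fin D.m, Integrable (fun x =>
      (Set.Iic (D.c ((min j k : Fin D.m) + 1))).indicator (1 : ℝ → ℝ) x *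
      (D.wsum w (unitSeq (j + 1)) * D.wsum w (unitSeq (k + 1)))) ν := fun j k =>
    ((integrable_const (1 : ℝ)).indicator measurableSet_Iic).mul_const _
  simp only [h]
  rw [integral_finsetSum _ fun j _ => integrable_finsetSum _ fun k _ => hi j k]
  refine Finset.sum_congr rfl fun j _ => ?_
  rw [integral_finsetSum _ fun k _ => hi j k]
  refine Finset.sum_congr rfl fun k _ => ?_
  rw [integral_mul_const, integral_indicator_one measurableSet_Iic, atBoundaries, cdf_eq_real]

end Measure

/-- An observation in group `i` produces a step function at the boundaries whose only increment is
in that group. -/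
lemma contrib_eq_of_mem {w : ℕ → ℝ} {i : ℕ} (hi : i ∈ Finset.Icc D.l (D.r + 1)) {x : ℝ}
    (hx : x ∈ Set.Ioc (D.c (i - 1)) (D.c i)) : D.contrib w x = w i := by
  have hb := D.l_bounds
  have hi' := Finset.mem_Icc.1 hi
  have h : D.contrib w x = D.wsum w (fun k => if i ≤ k then 1 else 0) := by
    refine D.wsum_congr w fun k hk => ?_
    have h0 := D.c_nonneg (show i - 1 ≤ D.m by omega)
    rw [D.ext_atBoundaries (G := fun y => if x ≤ y then 1 else 0)
      (if_neg (not_le.2 (h0.trans_lt hx.1))) hk]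
    by_cases hik : i ≤ k
    · rw [if_pos hik, if_pos (hx.2.trans (D.c_le_c hik hk))]
    · rw [if_neg hik, if_neg (not_le.2 (lt_of_le_of_lt (D.c_le_c (by omega) (by omega)) hx.1))]
  rw [h, wsum, Finset.sum_eq_single i _ (fun h => absurd hi h)]
  · rw [if_pos le_rfl, if_neg (by omega)]
    ring
  · intro k hk hki
    rw [Finset.mem_Icc] at hk
    rcases lt_or_gt_of_ne hki with h | h
    · simp [show ¬ i ≤ k by omega, show ¬ i ≤ k - 1 by omega]
    · simp [show i ≤ k by omega, show i ≤ k - 1 by omega]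

/-- The weights of the linear functional `N - μ H`. -/
noncomputable def centredShare (μ : ℝ) (i : ℕ) : ℝ := D.share i * (D.mid i - μ)

lemma wsum_centredShare (μ : ℝ) (p : ℕ → ℝ) : D.wsum (D.centredShare μ) p =
    D.wsum (fun i => D.share i * D.mid i) p - μ * D.wsum D.share p := by
  simp only [wsum, centredShare, Finset.mul_sum, ← Finset.sum_sub_distrib]
  exact Finset.sum_congr rfl fun i _ => by ring

lemma wsum_centredShare_Fvec {θ : ℝ} (hθ : 0 < θ) :
    D.wsum (D.centredShare (D.gMu (D.Fvec θ))) (D.ext (D.Fvec θ)) = 0 := by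
  rw [wsum_centredShare, ← N_eq_wsum, ← H_eq_wsum, gMu, div_mul_cancel₀ _ (D.H_Fvec_pos hθ).ne',
    sub_self]

/-- The quotient rule with `N = μ H` at `𝐅`: the gradient is that of the linear functional `N - μ
H`, divided by `H`. -/
lemma Dmu_eq {θ : ℝ} (hθ : 0 < θ) (j : Fin D.m) : D.Dmu θ j =
    D.wsum (D.centredShare (D.gMu (D.Fvec θ))) (unitSeq (j + 1)) / D.H (D.Fvec θ) := by
  have hH := (D.H_Fvec_pos hθ).ne'
  rw [Dmu, (D.hasDerivAt_gMu_update hH j).deriv, wsum_centredShare, gMu]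
  field_simp

/-- The entries of `Σ` are `F(min) - F_j F_k`. The product part contributes the square of `(N - μ
H)(𝐅) = 0`, and the rest is the second moment of one contribution. -/
lemma SigMu_eq {θ : ℝ} (hθ : 0 < θ) : D.SigMu θ = (D.H (D.Fvec θ))⁻¹ ^ 2 *
    ∫ x, D.contrib (D.centredShare (D.gMu (D.Fvec θ))) x ^ 2 ∂(expMeasure θ⁻¹) := by
  have := isProbabilityMeasure_expMeasure (inv_pos.2 hθ)
  have h0 := D.wsum_centredShare_Fvec hθ
  rw [wsum_ext_eq_sum] at h0
  rw [integral_contrib_sq]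
  set a : Fin D.m → ℝ :=
    fun j => D.wsum (D.centredShare (D.gMu (D.Fvec θ))) (unitSeq (j + 1)) with ha
  have hS : D.SigMu θ = (D.H (D.Fvec θ))⁻¹ ^ 2 * (∑ j, ∑ k, D.Fvec θ (min j k) * (a j * a k)
      - (∑ j, D.Fvec θ j * a j) * ∑ j, D.Fvec θ j * a j) := by
    rw [Finset.sum_mul_sum, ← Finset.sum_sub_distrib, Finset.mul_sum]
    simp only [SigMu, dotProduct, Matrix.mulVec, Sig, Matrix.of_apply, D.Dmu_eq hθ]
    refine Finset.sum_congr rfl fun j _ => ?_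
    rw [← Finset.sum_sub_distrib, Finset.mul_sum, Finset.mul_sum]
    refine Finset.sum_congr rfl fun k _ => ?_
    rcases le_total j k with h | h
    · rw [min_eq_left h, max_eq_right h]
      ring
    · rw [min_eq_right h, max_eq_left h]
      ring
  rw [hS, h0, mul_zero, sub_zero]
  rfl

lemma expMeasure_Ioc_pos {θ : ℝ} (hθ : 0 < θ) {a b : ℝ} (ha : 0 ≤ a) (hab : a < b) :
    0 < expMeasure θ⁻¹ (Set.Ioc a b) := by
  have := isProbabilityMeasure_expMeasure (inv_pos.2 hθ)
  rw [← measure_cdf (expMeasure θ⁻¹), StieltjesFunction.measure_Ioc, ENNReal.ofReal_pos, sub_pos]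
  exact strictMonoOn_expCdf hθ ha (ha.trans hab.le) hab

lemma SigMu_pos (h : D.t < D.c D.r) {θ : ℝ} (hθ : 0 < θ) : 0 < D.SigMu θ := by
  have hb := D.l_bounds
  have := isProbabilityMeasure_expMeasure (inv_pos.2 hθ)
  rw [SigMu_eq _ hθ]
  set μ := D.gMu (D.Fvec θ)
  refine mul_pos (pow_pos (inv_pos.2 (D.H_Fvec_pos hθ)) 2) ?_
  -- Since `mid r < mid (r + 1)`, the two cannot both equal `μ`, and both groups have positive
  -- share. The contribution is then a nonzero constant on a group of positive probability.
  obtain ⟨i, hi, hne⟩ : ∃ i ∈ Finset.Icc D.l (D.r + 1), D.centredShare μ i ≠ 0 := by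
    by_cases hr : D.mid D.r = μ
    · refine ⟨D.r + 1, by simp; omega, mul_ne_zero (by rw [share_r]; exact D.B₂_pos.ne') ?_⟩
      have := D.mid_lt_mid hb.2.1 (Nat.lt_succ_self D.r) le_rfl
      exact sub_ne_zero.2 (by rw [← hr]; exact this.ne')
    · exact ⟨D.r, by simp; omega, mul_ne_zero (D.share_r_pos h).ne' (sub_ne_zero.2 hr)⟩
  rw [integral_pos_iff_support_of_nonneg (fun x => sq_nonneg _)
    (D.memLp_contrib _ _ 2).integrable_sq]
  have hi' := Finset.mem_Icc.1 hi
  refine (expMeasure_Ioc_pos hθ (D.c_nonneg (show i - 1 ≤ D.m by omega))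
    (D.c_lt_c (show i - 1 < i by omega) (by omega))).trans_le (measure_mono fun x hx => ?_)
  rw [Function.mem_support, D.contrib_eq_of_mem hi hx]
  exact pow_ne_zero 2 hne

/-! ### Asymptotics of the estimators -/

section Sample

variable {Ω : Type*} [MeasurableSpace Ω] {P : Measure Ω} {X : ℕ → Ω → ℝ} {θ : ℝ}

lemma ae_empCdf_zero (hθ : 0 < θ) (hlaw : ∀ i, HasLaw (X i) (expMeasure θ⁻¹) P) :
    ∀ᵐ ω ∂P, ∀ n, empCdf (fun i => X i ω) n 0 = 0 := by
  have := isProbabilityMeasure_expMeasure (inv_pos.2 hθ)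
  have h : ∀ i, ∀ᵐ ω ∂P, ¬ X i ω ≤ 0 := by
    intro i
    rw [ae_iff]
    simp only [not_not]
    rw [(hlaw i).measure_eq (p := fun x => x ≤ 0) measurableSet_Iic]
    have h0 := expCdf_zero hθ
    rw [expCdf, cdf_eq_real, measureReal_eq_zero_iff] at h0
    exact h0
  filter_upwards [ae_all_iff.2 h] with ω hω n
  simp [empCdf, hω]

lemma ae_muHat_eq (hθ : 0 < θ) (hlaw : ∀ i, HasLaw (X i) (expMeasure θ⁻¹) P) :
    ∀ᵐ ω ∂P, ∀ n, D.muHat (fun i => X i ω) n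
      = D.gMu (D.atBoundaries (empCdf (fun i => X i ω) n)) := by
  filter_upwards [ae_empCdf_zero hθ hlaw] with ω hω n
  exact D.truncMean_eq_gMu (hω n)

lemma aemeasurable_comp_muHat (hθ : 0 < θ) (hlaw : ∀ i, HasLaw (X i) (expMeasure θ⁻¹) P)
    (g : ℝ → ℝ) (n : ℕ) : AEMeasurable (fun ω => g (D.muHat (fun i => X i ω) n)) P := by
  refine (aemeasurable_comp_empCdf (fun i => (hlaw i).aemeasurable)
    (fun j : Fin D.m => D.c (j + 1)) n fun p => g (D.gMu p)).congr ?_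
  filter_upwards [D.ae_muHat_eq hθ hlaw] with ω hω
  rw [hω n]
  rfl

lemma ae_tendsto_wsum_empCdf (hθ : 0 < θ) (hlaw : ∀ i, HasLaw (X i) (expMeasure θ⁻¹) P)
    (hindep : iIndepFun X P) (w : ℕ → ℝ) :
    ∀ᵐ ω ∂P, Tendsto (fun n => D.wsum w (D.ext (D.atBoundaries (empCdf (fun i => X i ω) n))))
      atTop (𝓝 (D.wsum w (D.ext (D.Fvec θ)))) := by
  have := isProbabilityMeasure_expMeasure (inv_pos.2 hθ)
  have h := ae_tendsto_mean hlaw hindep (D.measurable_contrib w)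
    ((D.memLp_contrib w _ 1).integrable le_rfl)
  rw [integral_contrib] at h
  simp only [wsum_empCdf]
  exact h

lemma ae_tendsto_muHat (hθ : 0 < θ) (hlaw : ∀ i, HasLaw (X i) (expMeasure θ⁻¹) P)
    (hindep : iIndepFun X P) :
    ∀ᵐ ω ∂P, Tendsto (fun n => D.muHat (fun i => X i ω) n) atTop (𝓝 (D.gMu (D.Fvec θ))) := by
  filter_upwards [D.ae_muHat_eq hθ hlaw, D.ae_tendsto_wsum_empCdf hθ hlaw hindep D.share,
    D.ae_tendsto_wsum_empCdf hθ hlaw hindep fun i => D.share i * D.mid i] with ω h1 h2 h3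
  simp only [h1]
  simp only [← H_eq_wsum, ← N_eq_wsum] at h2 h3
  exact h3.div h2 (D.H_Fvec_pos hθ).ne'

lemma isAN_muHat [IsProbabilityMeasure P] (hθ : 0 < θ)
    (hlaw : ∀ i, HasLaw (X i) (expMeasure θ⁻¹) P) (hindep : iIndepFun X P) :
    IsAN P (fun n ω => D.muHat (fun i => X i ω) n) (D.gMu (D.Fvec θ)) (D.SigMu θ) := by
  have := isProbabilityMeasure_expMeasure (inv_pos.2 hθ)
  have hH := D.H_Fvec_pos hθ
  set μ := D.gMu (D.Fvec θ) with hμ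
  rw [SigMu_eq _ hθ]
  refine IsAN.of_eventually_eq_mul
    (R := fun n ω => (D.H (D.atBoundaries (empCdf (fun i => X i ω) n)))⁻¹)
    (isAN_mean hlaw hindep (D.measurable_contrib (D.centredShare μ)) (D.memLp_contrib _ _ 2) ?_)
    (fun n => aemeasurable_comp_empCdf (fun i => (hlaw i).aemeasurable)
      (fun j : Fin D.m => D.c (j + 1)) n fun p => (D.H p)⁻¹)
    (fun n => D.aemeasurable_comp_muHat hθ hlaw id n) ?_ ?_
  · rw [integral_contrib]
    exact D.wsum_centredShare_Fvec hθ
  · filter_upwards [D.ae_tendsto_wsum_empCdf hθ hlaw hindep D.share] with ω h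
    simp only [← H_eq_wsum] at h
    exact h.inv₀ hH.ne'
  · filter_upwards [D.ae_muHat_eq hθ hlaw, D.ae_tendsto_wsum_empCdf hθ hlaw hindep D.share]
      with ω h1 h2
    simp only [← H_eq_wsum] at h2
    -- Only for large `n` is `H(F_n) > 0`, which the exact formula for `μ̂ - μ` needs.
    filter_upwards [h2.eventually (lt_mem_nhds hH)] with n hn
    rw [h1 n, ← wsum_empCdf, wsum_centredShare, ← N_eq_wsum, ← H_eq_wsum, gMu]
    field_simp
    ring

lemma isAN_thetaHat [IsProbabilityMeasure P] (h : D.t < D.c D.r) (hθ : 0 < θ)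
    (hlaw : ∀ i, HasLaw (X i) (expMeasure θ⁻¹) P) (hindep : iIndepFun X P) :
    IsAN P (fun n ω => D.thetaHat (fun i => X i ω) n) θ
      ((deriv D.gTheta (D.gtT θ)) ^ 2 * D.SigMu θ) := by
  have hd := (D.hasDerivAt_gTheta h hθ).differentiableAt
  have hμ := D.gtT_eq_gMu hθ
  -- Delta method: the random factor is the difference quotient `dslope` of `g_θ` at `μ`, evaluated
  -- at `μ̂`. It is continuous at `μ` because `g_θ` is differentiable there, and the product
  -- identity holds for every `n`.
  refine IsAN.of_eventually_eq_mul (D.isAN_muHat hθ hlaw hindep)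
    (D.aemeasurable_comp_muHat hθ hlaw (dslope D.gTheta (D.gtT θ)))
    (D.aemeasurable_comp_muHat hθ hlaw D.gTheta) ?_ ?_
  · filter_upwards [D.ae_tendsto_muHat hθ hlaw hindep] with ω hω
    rw [← hμ] at hω
    rw [← dslope_same]
    exact (continuousAt_dslope_same.2 hd).tendsto.comp hω
  · refine Eventually.of_forall fun ω => Eventually.of_forall fun n => ?_
    rw [← hμ, mul_comm, ← smul_eq_mul, sub_smul_dslope, D.gTheta_gtT h hθ]
    rfl

lemma tendsto_measure_thetaHat [IsProbabilityMeasure P] (h : D.t < D.c D.r) (hθ : 0 < θ)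
    (hlaw : ∀ i, HasLaw (X i) (expMeasure θ⁻¹) P) (hindep : iIndepFun X P) :
    Tendsto (fun n => P {ω | 0 < D.thetaHat (fun i => X i ω) n ∧
      D.gtT (D.thetaHat (fun i => X i ω) n) = D.muHat (fun i => X i ω) n}) atTop (𝓝 1) := by
  have hlim := D.ae_tendsto_muHat hθ hlaw hindep
  rw [← D.gtT_eq_gMu hθ] at hlim
  refine tendsto_of_tendsto_of_tendsto_of_le_of_le (tendsto_measure_of_ae_tendsto
    (fun n => (D.aemeasurable_comp_muHat hθ hlaw id n).aestronglyMeasurable) hlim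
    (D.image_gtT_mem_nhds h hθ)) tendsto_const_nhds
    (fun n => measure_mono fun ω hω => ?_) fun n => prob_le_one
  exact Function.invFunOn_pos hω

end Sample

end GroupedTrunc

theorem mainTheorem3 {Ω : Type*} [MeasurableSpace Ω] (P : Measure Ω) [IsProbabilityMeasure P]
    (D : GroupedTrunc) (θ : ℝ) (hθ : 0 < θ) (X : ℕ → Ω → ℝ)
    (hlaw : ∀ i, HasLaw (X i) (expMeasure θ⁻¹) P) (hindep : iIndepFun X P) :
    -- the sample and population truncated means are `g_μ` of the values at the boundaries
    (∀ n, ∀ᵐ ω ∂P, D.muHat (fun i => X i ω) n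
        = D.gMu (D.atBoundaries (empCdf (fun i => X i ω) n)))
    ∧ (∀ θ' > 0, 0 < D.H (D.Fvec θ') ∧ D.gtT θ' = D.gMu (D.Fvec θ'))
    -- asymptotic normality of `μ̂`
    ∧ IsAN P (fun n ω => D.muHat (fun i => X i ω) n) (D.gMu (D.Fvec θ)) (D.SigMu θ)
    -- the partial derivatives of `g_μ`
    ∧ (D.l < D.r → ∀ p : Fin D.m → ℝ, D.H p ≠ 0 → ∀ j : Fin D.m,
        HasDerivAt (fun s => D.gMu (Function.update p j s)) (D.partialLt p (j + 1)) (p j))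
    ∧ (D.l = D.r → ∀ p : Fin D.m → ℝ, D.H p ≠ 0 → ∀ j : Fin D.m,
        HasDerivAt (fun s => D.gMu (Function.update p j s)) (D.partialEq p (j + 1)) (p j))
    -- the estimator of `θ`, when the truncation points are not in one closed group interval
    ∧ (D.t < D.c D.r →
        0 < D.SigMu θ
        -- `g_θ` is the inverse function of `g_{tT}`
        ∧ (∀ θ' > 0, D.gTheta (D.gtT θ') = θ')
        -- the derivative of `g_θ`
        ∧ (D.l = D.r → ∀ θ' > 0, D.cLambda θ' + D.cDelta θ' (D.gtT θ') ≠ 0 ∧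
            HasDerivAt D.gTheta
              ((D.cA - D.cB θ') / (D.cLambda θ' + D.cDelta θ' (D.gtT θ'))) (D.gtT θ'))
        ∧ (D.l < D.r → ∀ θ' > 0, D.cGamma θ' + D.cDelta θ' (D.gtT θ') ≠ 0 ∧
            HasDerivAt D.gTheta
              ((D.cA - D.cB θ') / (D.cGamma θ' + D.cDelta θ' (D.gtT θ'))) (D.gtT θ'))
        -- `θ̂` solves its equation with probability tending to one
        ∧ Tendsto (fun n => P {ω | 0 < D.thetaHat (fun i => X i ω) n ∧
              D.gtT (D.thetaHat (fun i => X i ω) n) = D.muHat (fun i => X i ω) n})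
            atTop (𝓝 1)
        -- asymptotic normality of `θ̂`
        ∧ 0 < (deriv D.gTheta (D.gtT θ)) ^ 2 * D.SigMu θ
        ∧ IsAN P (fun n ω => D.thetaHat (fun i => X i ω) n) θ
            ((deriv D.gTheta (D.gtT θ)) ^ 2 * D.SigMu θ)) := by 
  refine ⟨fun n => ?_, fun θ' hθ' => ⟨D.H_Fvec_pos hθ', D.gtT_eq_gMu hθ'⟩,
    D.isAN_muHat hθ hlaw hindep, fun hlr p hp j => ?_, fun hlr p hp j => ?_, fun h => ?_⟩
  · filter_upwards [D.ae_muHat_eq hθ hlaw] with ω hω using hω n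
  · exact (D.hasDerivAt_gMu_update hp j).congr_deriv (D.partial_eq_of_lt hlr hp (by omega))
  · exact (D.hasDerivAt_gMu_update hp j).congr_deriv (D.partial_eq_of_eq hlr (by omega))
  have hne {θ' : ℝ} (hθ' : 0 < θ') := (D.cGamma_add_cDelta_pos h hθ').ne'
  refine ⟨D.SigMu_pos h hθ, fun θ' hθ' => D.gTheta_gtT h hθ', fun hlr θ' hθ' => ?_,
    fun _ θ' hθ' => ⟨hne hθ', D.hasDerivAt_gTheta h hθ'⟩,
    D.tendsto_measure_thetaHat h hθ hlaw hindep, ?_, D.isAN_thetaHat h hθ hlaw hindep⟩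
  · rw [D.cLambda_eq_cGamma hlr]
    exact ⟨hne hθ', D.hasDerivAt_gTheta h hθ'⟩
  · rw [(D.hasDerivAt_gTheta h hθ).deriv]
    exact mul_pos (pow_pos (div_pos (D.cA_sub_cB_pos hθ) (D.cGamma_add_cDelta_pos h hθ)) 2)
      (D.SigMu_pos h hθ)
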